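/- **Theorem 3 (PLE lower bound).** Consider the external-memory (disk access) model: an internal memory of $M$ cells and an unbounded disk, divided into blocks of $B$ cells, with $1\le B\le M$; one I/O transfers one block between disk and memory, and everything else is free. The records to be ordered are indivisible and accessible only through comparisons, and two records can be compared only while both are in memory in their entirety. In the batched predecessor problem $\mathrm{PLE}(S,L)$ the input, stored on disk, consists of $S\ge 1$ small records of unit size, given in sorted order, followed by $L/w\ge 1$ unsorted large records of size $w$ each (total volume $L$), where $w$ is an integer with $1<w\le M/2$; all keys are distinct. A *stripe* is a maximal set of large records no two of which are separated by a small record in the sorted order, and $k$ is the number of stripes, $1\le k\le\min\{L/w,\,S+1\}$. The output is the set of all records stored on disk such that all of them are in sorted order by disk address, except that the order of the large records within a stripe is arbitrary. There is an absolute constant $c>0$ such that, for all such $B,M,w,S,L,k$, every deterministic comparison-based algorithm that solves $\mathrm{PLE}(S,L)$ correctly on all inputs with exactly $k$ stripes (it may know $k$ and all other parameters) uses in the worst case, over the inputs with exactly $k$ stripes, at least $$c\cdot\min\left\{\frac{kw}{B}\log_M S+\frac{L}{B}\log_M k,\ \ \frac{k}{B}\log_2 S+\frac{L}{wB}\log_2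 k+\frac{L}{B}\right\}$$ I/Os. -/

import Mathlib

namespace PLE

/-- Records: `S` small ones and `n` large ones. -/
abbrev Rec (S n : ℕ) : Type := Fin S ⊕ Fin n

/-- Number of memory cells of a record: small records have unit size, large ones size `w`. -/
def size (w : ℕ) {S n : ℕ} : Rec S n → ℕ
  | .inl _ => 1
  | .inr _ => w

/-- The content of one nonblank cell: `(r, t)` is the `t`-th unit of the record `r`. -/
abbrev Piece (S n : ℕ) : Type := Rec S n × ℕ

/-- All the pieces of a record. -/
def pieces (w : ℕ) {S n : ℕ} (r : Rec S n) : Finset (Piece S n) :=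
  (Finset.range (size w r)).image fun t => (r, t)

/-- The unbounded external disk, cell by cell. With block size `B`, block number `b` consists of
the cells `b * B, …, b * B + (B - 1)`. -/
abbrev Disk (S n : ℕ) : Type := ℕ → Option (Piece S n)

/-- The pieces stored in block `b`. -/
def blockPieces (B : ℕ) {S n : ℕ} (d : Disk S n) (b : ℕ) : Finset (Piece S n) :=
  (Finset.range B).biUnion fun t => (d (b * B + t)).toFinset

/-- Overwrite block `b`: its cell number `t < B` receives `content t`. -/
def writeBlock (B : ℕ) {S n : ℕ} (d : Disk S n) (b : ℕ) (content : ℕ → Option (Piece S n)) :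
    Disk S n :=
  fun a => if a / B = b then content (a % B) else d a

/-- The disk at the start: the small records in sorted order, followed by the large records. -/
def startDisk (w S n : ℕ) : Disk S n := fun a =>
  if h : a < S then some (.inl ⟨a, h⟩, 0)
  else if h' : (a - S) / w < n then some (.inr ⟨(a - S) / w, h'⟩, (a - S) % w)
  else none

/-- Deterministic comparison-based external-memory algorithms, as decision trees. The algorithm
may depend on all the parameters, and on the outcomes of all earlier comparisons.
* `done loc`: stop; the output consists of the copies of the records `r` at the disk
  addresses `loc r`;
* `read b`: transfer block `b` of the disk to memory;
* `write b content`: transfer a block from memory to block `b` of the disk;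
* `keep P`: erase from memory everything that is not in `P`;
* `compare x y A A'`: compare two records; go on with `A` if `x` is smaller, else with `A'`. -/
inductive Algorithm (S n : ℕ) : Type
  | done (loc : Rec S n → ℕ) : Algorithm S n
  | read (b : ℕ) (next : Algorithm S n) : Algorithm S n
  | write (b : ℕ) (content : ℕ → Option (Piece S n)) (next : Algorithm S n) : Algorithm S n
  | keep (P : Finset (Piece S n)) (next : Algorithm S n) : Algorithm S n
  | compare (x y : Rec S n) (ifLess ifNotLess : Algorithm S n) : Algorithm S n

/-- What is there after a run: the number of block transfers, the disk, and the addresses of the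
output. -/
structure Outcome (S n : ℕ) where
  transfers : ℕ
  disk : Disk S n
  loc : Rec S n → ℕ

/-- Count one more block transfer. -/
def Outcome.charge {S n : ℕ} (o : Outcome S n) : Outcome S n :=
  { o with transfers := o.transfers + 1 }

open Classical in
/-- Run an algorithm with block size `B`, memory size `M` and large records of size `w`, on the
records with the given keys, from memory content `mem` and disk content `d`. Each block transfer
costs one; everything else is free. The result is `none` if the run makes an illegal step: a read
that overfills the memory, a write of pieces that are not in memory, or a comparison of two
records that are not both in memory in their entirety. -/
noncomputable def run (B M w : ℕ) {S n : ℕ} (key : Rec S n → ℝ) :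
    Algorithm S n → Finset (Piece S n) → Disk S n → Option (Outcome S n)
  | .done loc, _, d => some ⟨0, d, loc⟩
  | .read b next, mem, d =>
      if (mem ∪ blockPieces B d b).card ≤ M then
        (run B M w key next (mem ∪ blockPieces B d b) d).map Outcome.charge
      else none
  | .write b content next, mem, d =>
      if ∀ t < B, ∀ p, content t = some p → p ∈ mem then
        (run B M w key next mem (writeBlock B d b content)).map Outcome.charge
      else none
  | .keep P next, mem, d => run B M w key next (mem ∩ P) d
  | .compare x y A A', mem, d =>
      if pieces w x ⊆ mem ∧ pieces w y ⊆ mem then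
        if key x < key y then run B M w key A mem d else run B M w key A' mem d
      else none

/-- The inputs: distinct keys, the small records being indexed in sorted order. -/
structure IsInput {S n : ℕ} (key : Rec S n → ℝ) : Prop where
  distinct : Function.Injective key
  sorted : StrictMono fun i : Fin S => key (.inl i)

open Classical in
/-- The small records that precede the large record `a` in the sorted order. -/
noncomputable def below {S n : ℕ} (key : Rec S n → ℝ) (a : Fin n) : Finset (Fin S) :=
  Finset.univ.filter fun i => key (.inl i) < key (.inr a)

/-- Two large records lie in the same stripe if no small record separates them. -/
def SameStripe {S n : ℕ} (key : Rec S n → ℝ) (a b : Fin n) : Prop :=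
  ¬ ∃ i : Fin S, (key (.inr a) < key (.inl i) ∧ key (.inl i) < key (.inr b)) ∨
    (key (.inr b) < key (.inl i) ∧ key (.inl i) < key (.inr a))

/-- The number of stripes of large records. Large records are in the same stripe exactly if they
have the same small records below them (`sameStripe_iff`). -/
noncomputable def numStripes {S n : ℕ} (key : Rec S n → ℝ) : ℕ :=
  (Finset.univ.image (below key)).card

theorem sameStripe_iff {S n : ℕ} {key : Rec S n → ℝ} (h : IsInput key) (a b : Fin n) :
    SameStripe key a b ↔ below key a = below key b := by
  have hne : ∀ (i : Fin S) (c : Fin n), key (.inl i) ≠ key (.inr c) := fun i c hc => by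
    simpa using h.distinct hc
  constructor
  · intro hs
    ext i
    simp only [below, Finset.mem_filter, Finset.mem_univ, true_and]
    constructor
    · intro h1
      by_contra h2
      exact hs ⟨i, Or.inr ⟨lt_of_le_of_ne (not_lt.mp h2) (hne i b).symm, h1⟩⟩
    · intro h1
      by_contra h2
      exact hs ⟨i, Or.inl ⟨lt_of_le_of_ne (not_lt.mp h2) (hne i a).symm, h1⟩⟩
  · rintro hab ⟨i, ⟨h1, h2⟩ | ⟨h1, h2⟩⟩
    · have : i ∈ below key a := by rw [hab]; simpa [below] using h2
      simp only [below, Finset.mem_filter] at this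
      exact lt_asymm h1 this.2
    · have : i ∈ below key b := by rw [← hab]; simpa [below] using h2
      simp only [below, Finset.mem_filter] at this
      exact lt_asymm h1 this.2

/-- The outcome is a correct placement of the large records: there is a copy of each record `r`
on disk, from address `loc r` on, and in the order of these addresses all records are sorted, up
to the order of the large records within a stripe. -/
structure IsPlacement (w : ℕ) {S n : ℕ} (key : Rec S n → ℝ) (o : Outcome S n) : Prop where
  stored : ∀ r, ∀ t < size w r, o.disk (o.loc r + t) = some (r, t)
  small_small : ∀ i j : Fin S, key (.inl i) < key (.inl j) → o.loc (.inl i) < o.loc (.inl j)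
  small_large : ∀ (i : Fin S) (a : Fin n),
    key (.inl i) < key (.inr a) → o.loc (.inl i) < o.loc (.inr a)
  large_small : ∀ (a : Fin n) (i : Fin S),
    key (.inr a) < key (.inl i) → o.loc (.inr a) < o.loc (.inl i)
  large_large : ∀ a b : Fin n,
    key (.inr a) < key (.inr b) → ¬ SameStripe key a b → o.loc (.inr a) < o.loc (.inr b)

/-- The algorithm `A` solves the placement problem for `S` small records and `n` large records of
size `w` on all inputs with exactly `k` stripes, within `T` block transfers, for block size `B`
and memory size `M`. The memory is empty at the start. Nothing is asked of `A` on inputs with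
another number of stripes. -/
def SolvesWithin (B M w : ℕ) {S n : ℕ} (k T : ℕ) (A : Algorithm S n) : Prop :=
  ∀ key : Rec S n → ℝ, IsInput key → numStripes key = k →
    ∃ o, run B M w key A ∅ (startDisk w S n) = some o ∧ IsPlacement w key o ∧ o.transfers ≤ T

end PLE

/-! It suffices to consider inputs encoded by a map `f`, where `f a` is the number of small records
below the large record `a`; the stripes are then the values of `f`. The proof combines a count of
these inputs with a count of the cells that must be moved.

Information. Let `F` be a set of inputs that the algorithm has not yet told apart, with a list `l`
of records sorted alike in all of them. If `l` contains the small records and the complete large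
records in memory, no comparison splits `F`. A small record newly read can enter only one run of `r`
large records, since its place among the small ones is known. Weighting a run by its Catalan number
makes the sum over all splits of the run equal to `catalan (r + 1)`, at most `4 * catalan r`,
however long the run is. When a large record is completed, `l` is first pruned to at most `2 * M`
records; the new record has at most `2 * M + 1` places and raises the weight by a factor of at most
4. The `w` pieces of the record pay for this: every piece of a record outside `l` carries a factor
`R`, where `R ^ w ≥ 4 * (2 * M + 1)`. So each piece read costs at most a factor `R`
(`card_le_of_insert`), and `T` transfers distinguish at most `R ^ (B * T)` inputs (`card_le_of_run`,
`logb_card_le`). Taking `R = 2 ^ (2 + 3 * log₂ M / w)` and comparing with `four_mul_logb_card_ge`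
bounds `E = k log₂ S + n log₂ k`.

Volume. For `k ≥ 2`, two large records not read completely could be rearranged without changing the
run (`pred_mul_le_of_two_le`). For `k = 1`, putting the stripe first forces all the small or all the
large records to be rewritten (`volume_le_of_one_stripe`). `min_le_of_info` combines both bounds,
according to whether `w` or `log₂ M` is larger. -/

namespace PLE

/-! ### Inputs encoded by maps into the `S + 1` gaps between small records -/

/-- The keys of the input in which exactly the first `f a` small records precede the large
record `a`. -/
def cfgKey {S n : ℕ} (f : Fin n → Fin (S + 1)) : Rec S n → ℝ
  -- Small keys are the positive multiples of `n + 1`; the offset `a + 1` lies between 1 and `n`, so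
  -- large keys avoid these multiples and differ within a gap.
  | .inl i => (((i + 1) * (n + 1) : ℕ) : ℝ)
  | .inr a => (((f a : ℕ) * (n + 1) + (a + 1) : ℕ) : ℝ)

theorem cfgKey_small_lt_large {S n : ℕ} (f : Fin n → Fin (S + 1)) (i : Fin S) (a : Fin n) :
    cfgKey f (.inl i) < cfgKey f (.inr a) ↔ (i : ℕ) < f a := by
  simp only [cfgKey, Nat.cast_lt]
  have ha := a.2
  constructor
  · intro h
    by_contra hc
    have : (f a : ℕ) * (n + 1) ≤ i * (n + 1) := Nat.mul_le_mul_right _ (by omega)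
    have h2 : ((i : ℕ) + 1) * (n + 1) = i * (n + 1) + (n + 1) := by ring
    omega
  · intro h
    have : ((i : ℕ) + 1) * (n + 1) ≤ f a * (n + 1) := Nat.mul_le_mul_right _ (by omega)
    omega

theorem cfgKey_large_lt_small {S n : ℕ} (f : Fin n → Fin (S + 1)) (i : Fin S) (a : Fin n) :
    cfgKey f (.inr a) < cfgKey f (.inl i) ↔ (f a : ℕ) ≤ i := by
  simp only [cfgKey, Nat.cast_lt]
  have ha := a.2
  constructor
  · intro h
    by_contra hc
    have : ((i : ℕ) + 1) * (n + 1) ≤ f a * (n + 1) := Nat.mul_le_mul_right _ (by omega)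
    omega
  · intro h
    have : (f a : ℕ) * (n + 1) ≤ i * (n + 1) := Nat.mul_le_mul_right _ (by omega)
    have h2 : ((i : ℕ) + 1) * (n + 1) = i * (n + 1) + (n + 1) := by ring
    omega

theorem cfgKey_small_lt_small {S n : ℕ} (f : Fin n → Fin (S + 1)) (i j : Fin S) :
    cfgKey f (.inl i) < cfgKey f (.inl j) ↔ i < j := by
  simp only [cfgKey, Nat.cast_lt, Fin.lt_def]
  rw [Nat.mul_lt_mul_right (by omega)]
  omega

theorem isInput_cfgKey {S n : ℕ} (f : Fin n → Fin (S + 1)) : IsInput (cfgKey f) where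
  sorted := fun i j h => (cfgKey_small_lt_small f i j).2 h
  distinct := by
    rintro (i | a) (j | b) h
    · simp only [cfgKey, Nat.cast_inj] at h
      have := Nat.eq_of_mul_eq_mul_right (by omega) h
      congr 1
      exact Fin.ext (by omega)
    · rcases lt_or_ge (i : ℕ) (f b) with h' | h'
      · exact absurd h ((cfgKey_small_lt_large f i b).2 h').ne
      · exact absurd h ((cfgKey_large_lt_small f i b).2 h').ne'
    · rcases lt_or_ge (j : ℕ) (f a) with h' | h'
      · exact absurd h ((cfgKey_small_lt_large f j a).2 h').ne'
      · exact absurd h ((cfgKey_large_lt_small f j a).2 h').ne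
    · simp only [cfgKey, Nat.cast_inj] at h
      have ha := a.2
      have hb := b.2
      have h2 := congrArg (· % (n + 1)) (show (a + 1 : ℕ) + (n + 1) * f a = (b + 1) + (n + 1) * f b
        by linarith)
      simp only [Nat.add_mul_mod_self_left] at h2
      rw [Nat.mod_eq_of_lt (by omega), Nat.mod_eq_of_lt (by omega)] at h2
      congr 1
      exact Fin.ext (by omega)

theorem below_cfgKey {S n : ℕ} (f : Fin n → Fin (S + 1)) (a : Fin n) :
    below (cfgKey f) a = Finset.univ.filter fun i : Fin S => (i : ℕ) < f a := by
  ext i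
  simp [below, cfgKey_small_lt_large]

theorem numStripes_cfgKey {S n : ℕ} (f : Fin n → Fin (S + 1)) :
    numStripes (cfgKey f) = (Finset.univ.image f).card := by
  classical
  have h : below (cfgKey f)
      = (fun g : Fin (S + 1) => Finset.univ.filter fun i : Fin S => (i : ℕ) < g) ∘ f :=
    funext (below_cfgKey f)
  have inj : Function.Injective
      (fun g : Fin (S + 1) => Finset.univ.filter fun i : Fin S => (i : ℕ) < g) := by
    intro g g' hg
    simp only [Finset.ext_iff, Finset.mem_filter, Finset.mem_univ, true_and] at hg
    apply Fin.ext
    by_contra hne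
    rcases lt_or_gt_of_ne hne with hlt | hlt
    · have := hg ⟨g, by omega⟩
      simp at this
      omega
    · have := hg ⟨g', by omega⟩
      simp at this
      omega
  rw [numStripes, ← Finset.card_image_of_injective _ inj, Finset.image_image]
  congr 1
  rw [h]

/-- A placement determines, for every large record, the small records that precede it. -/
theorem eq_of_isPlacement {w S n : ℕ} {f f' : Fin n → Fin (S + 1)} {o : Outcome S n}
    (h : IsPlacement w (cfgKey f) o) (h' : IsPlacement w (cfgKey f') o) : f = f' := by
  have key : ∀ {g g' : Fin n → Fin (S + 1)}, IsPlacement w (cfgKey g) o →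
      IsPlacement w (cfgKey g') o → ∀ a, (g a : ℕ) ≤ g' a := by
    intro g g' hg hg' a
    by_contra hlt
    -- If `g' a < g a`, the small record with index `g' a` must precede `a` for `g` and follow it
    -- for `g'`, at the same addresses.
    have hga := (g a).2
    have h1 := hg.small_large ⟨g' a, by omega⟩ a ((cfgKey_small_lt_large _ _ _).2 (by simp; omega))
    have h2 := hg'.large_small a ⟨g' a, by omega⟩ ((cfgKey_large_lt_small _ _ _).2 (by simp))
    omega
  exact funext fun a => Fin.ext (le_antisymm (key h h' a) (key h' h a))

/-! ### Knowledge lists and their weights -/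

/-- The product of the Catalan numbers of the lengths of the runs of large records in a list of
records, where `g` large records come before the list. -/
def runWeight {S n : ℕ} : ℕ → List (Rec S n) → ℕ
  | g, [] => catalan g
  | g, .inl _ :: l => catalan g * runWeight 0 l
  | g, .inr _ :: l => runWeight (g + 1) l

/-- The ratio of consecutive Catalan numbers is `2 * (2 * g + 1) / (g + 2)`, which lies between 1
and 4; both bounds below follow from this. -/
theorem succ_mul_catalan_succ (g : ℕ) :
    (g + 2) * catalan (g + 1) = 2 * (2 * g + 1) * catalan g := by
  have h1 := Nat.succ_mul_centralBinom_succ g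
  have h2 := succ_mul_catalan_eq_centralBinom (g + 1)
  have h3 := succ_mul_catalan_eq_centralBinom g
  rw [← h2, ← h3] at h1
  have : (g + 1) * ((g + 2) * catalan (g + 1)) = (g + 1) * (2 * (2 * g + 1) * catalan g) := by
    linarith
  exact Nat.eq_of_mul_eq_mul_left (by omega) this

theorem catalan_pos (g : ℕ) : 0 < catalan g := by
  have := succ_mul_catalan_eq_centralBinom g
  have := Nat.centralBinom_pos g
  by_contra h
  have : catalan g = 0 := by omega
  simp_all

theorem catalan_succ_le (g : ℕ) : catalan (g + 1) ≤ 4 * catalan g := by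
  have := succ_mul_catalan_succ g
  by_contra h
  push Not at h
  nlinarith [catalan_pos g]

theorem catalan_le_succ (g : ℕ) : catalan g ≤ catalan (g + 1) := by
  have := succ_mul_catalan_succ g
  rcases g with _ | g
  · simp
  by_contra h
  push Not at h
  nlinarith [catalan_pos (g + 1)]

section
variable {S n : ℕ}

theorem runWeight_pos (l : List (Rec S n)) : ∀ g, 0 < runWeight g l := by
  induction l with
  | nil => exact catalan_pos
  | cons x l ih =>
    rcases x with i | a
    · exact fun g => Nat.mul_pos (catalan_pos g) (ih 0)
    · exact fun g => ih _

theorem runWeight_succ_le (l : List (Rec S n)) :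
    ∀ g, runWeight (g + 1) l ≤ 4 * runWeight g l := by
  induction l with
  | nil => exact catalan_succ_le
  | cons x l ih =>
    rcases x with i | a
    · intro g
      simp only [runWeight]
      rw [← mul_assoc]
      exact Nat.mul_le_mul_right _ (catalan_succ_le g)
    · exact fun g => ih _

theorem runWeight_le_succ (l : List (Rec S n)) :
    ∀ g, runWeight g l ≤ runWeight (g + 1) l := by
  induction l with
  | nil => exact catalan_le_succ
  | cons x l ih =>
    rcases x with i | a
    · exact fun g => Nat.mul_le_mul_right _ (catalan_le_succ g)
    · exact fun g => ih _

theorem runWeight_insert_large (a : Fin n) (l₂ l₁ : List (Rec S n)) :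
    ∀ g, runWeight g (l₁ ++ .inr a :: l₂) ≤ 4 * runWeight g (l₁ ++ l₂) := by
  induction l₁ with
  | nil => exact fun g => runWeight_succ_le l₂ g
  | cons x l ih =>
    rcases x with i | b
    · intro g
      simp only [List.cons_append, runWeight]
      rw [mul_left_comm]
      exact Nat.mul_le_mul_left _ (ih 0)
    · exact fun g => ih _

theorem runWeight_append_small (i : Fin S) (l₂ l₁ : List (Rec S n)) :
    ∀ g, runWeight g (l₁ ++ .inl i :: l₂) = runWeight g l₁ * runWeight 0 l₂ := by
  induction l₁ with
  | nil => exact fun g => rfl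
  | cons x l ih =>
    rcases x with j | b
    · intro g
      simp only [List.cons_append, runWeight, ih, mul_assoc]
    · exact fun g => ih _

theorem runWeight_large_run (r : List (Rec S n)) (hr : ∀ x ∈ r, x.isRight) :
    ∀ g, runWeight g r = catalan (g + r.length) := by
  induction r with
  | nil => exact fun g => rfl
  | cons x l ih =>
    rcases x with j | b
    · simpa using hr (.inl j)
    · intro g
      simp only [runWeight, List.length_cons]
      rw [ih fun x hx => hr x (List.mem_cons_of_mem _ hx)]
      congr 1
      omega

/-- Where a small record `s` can be inserted into a sorted list: only in one run `r` of large
records. -/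
theorem exists_run (s : Fin S) (l : List (Rec S n)) (hs : Sum.inl s ∉ l) :
    (l.Pairwise fun x y => ∀ i j, x = .inl i → y = .inl j → i < j) →
    ∃ (X r Y : List (Rec S n)) (α : ℕ), l = X ++ (r ++ Y) ∧ (∀ x ∈ r, x.isRight) ∧
      (∀ m, runWeight 0 (X ++ (m ++ Y)) = α * runWeight 0 m) ∧
      (X = [] ∨ ∃ X' i, X = X' ++ [.inl i] ∧ i < s) ∧
      (Y = [] ∨ ∃ Y' i, Y = .inl i :: Y' ∧ s < i) := by
  induction l with
  | nil => exact fun _ => ⟨[], [], [], 1, by simp⟩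
  | cons x l ih =>
    intro hp
    rw [List.pairwise_cons] at hp
    obtain ⟨X, r, Y, α, hl, hr, hw, hX, hY⟩ := ih (fun h => hs (List.mem_cons_of_mem _ h)) hp.2
    rcases x with i | a
    · have hne : s ≠ i := fun h => hs (by simp [h])
      rcases lt_or_gt_of_ne hne with hlt | hlt
      -- Here `s` precedes the first small record `i`, so its run ends just before `i`; large
      -- records further left join it in the next case.
      · refine ⟨[], [], .inl i :: l, runWeight 0 l, by simp, by simp, fun m => ?_, Or.inl rfl,
          Or.inr ⟨l, i, rfl, hlt⟩⟩
        rw [List.nil_append, runWeight_append_small, mul_comm]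
      · refine ⟨.inl i :: X, r, Y, α, by simp [hl], hr, fun m => ?_, Or.inr ?_, hY⟩
        · simp [runWeight, hw]
        · rcases hX with rfl | ⟨X', j, rfl, hj⟩
          · exact ⟨[], i, rfl, hlt⟩
          · exact ⟨.inl i :: X', j, rfl, hj⟩
    · rcases hX with rfl | ⟨X', j, rfl, hj⟩
      · refine ⟨[], .inr a :: r, Y, α, by simp [hl], ?_, hw, Or.inl rfl, hY⟩
        intro x hx
        rcases List.mem_cons.1 hx with rfl | hx
        · rfl
        · exact hr x hx
      -- The small record `j` already closes off the run of `s`, so `a` belongs to an earlier run.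
      -- It changes only `α`, in which it appears as the initial count 1.
      · refine ⟨.inr a :: (X' ++ [.inl j]), r, Y, ?_⟩
        rcases hY with rfl | ⟨Y', i, rfl, hi⟩
        · refine ⟨runWeight 1 X', by simp [hl], hr, fun m => ?_, Or.inr ⟨.inr a :: X', j, rfl, hj⟩,
            Or.inl rfl⟩
          simp [runWeight, runWeight_append_small]
        · refine ⟨runWeight 1 X' * runWeight 0 Y', by simp [hl], hr, fun m => ?_,
            Or.inr ⟨.inr a :: X', j, rfl, hj⟩, Or.inr ⟨Y', i, rfl, hi⟩⟩
          simp [runWeight, runWeight_append_small]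
          ring

/-! ### Pruning a knowledge list to the size of the memory -/

open Classical in
/-- Drop from a list the large records outside `Q`, and the small records outside `Q` that do not
separate two runs of large records. -/
noncomputable def prune (Q : Finset (Rec S n)) : List (Rec S n) → List (Rec S n)
  | [] => []
  | x :: l =>
    if x ∈ Q then x :: prune Q l
    else if x.isLeft ∧ ∃ a l', prune Q l = .inr a :: l' then x :: prune Q l else prune Q l

theorem prune_sublist (Q : Finset (Rec S n)) (l : List (Rec S n)) :
    (prune Q l).Sublist l := by
  induction l with
  | nil => exact List.Sublist.slnil
  | cons x l ih =>
    unfold prune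
    split_ifs
    · exact ih.cons_cons x
    · exact ih.cons_cons x
    · exact ih.cons x

theorem mem_prune {Q : Finset (Rec S n)} {x : Rec S n} (hx : x ∈ Q) (l : List (Rec S n)) :
    x ∈ prune Q l ↔ x ∈ l := by
  refine ⟨fun h => (prune_sublist Q l).subset h, fun h => ?_⟩
  induction l with
  | nil => exact h
  | cons y l ih =>
    unfold prune
    rcases List.mem_cons.1 h with rfl | h
    · simp [hx]
    · split_ifs
      · exact List.mem_cons_of_mem _ (ih h)
      · exact List.mem_cons_of_mem _ (ih h)
      · exact ih h

/-- Dropping a large record shortens a run. A small record is dropped only if no large record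
follows it in the pruned list, where it bounds an empty run of weight `catalan 0 = 1`. Dropping a
real separator would merge two runs and could raise the weight, which is why `prune` keeps it. -/
theorem runWeight_prune_le (Q : Finset (Rec S n)) (l : List (Rec S n)) :
    ∀ g, runWeight g (prune Q l) ≤ runWeight g l := by
  induction l with
  | nil => exact fun g => le_rfl
  | cons x l ih =>
    intro g
    unfold prune
    have hkeep : runWeight g (x :: prune Q l) ≤ runWeight g (x :: l) := by
      rcases x with i | a
      · exact Nat.mul_le_mul_left _ (ih 0)
      · exact ih _
    split_ifs with h1 h2
    · exact hkeep
    · exact hkeep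
    · rcases x with i | a
      · refine le_trans ?_ hkeep
        simp only [Sum.isLeft_inl, true_and] at h2
        rcases hp : prune Q l with _ | ⟨j | b, l'⟩
        · simp [runWeight]
        · simp [runWeight]
        · exact absurd ⟨b, l', hp⟩ h2
      · exact (ih g).trans (runWeight_le_succ l g)

-- Every separator kept from outside `Q` is charged to the large record of `Q` right after it. The
-- induction carries one unit of slack while the pruned list starts with a large record, to pay for
-- the separator that may come next.
open Classical in
theorem length_prune_le (Q : Finset (Rec S n)) (l : List (Rec S n)) (hl : l.Nodup) :
    (prune Q l).length ≤ 2 * Q.card := by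
  suffices h : (prune Q l).length + (if ∃ a l', prune Q l = .inr a :: l' then 1 else 0)
      ≤ 2 * (l.filter (· ∈ Q)).length by
    have : (l.filter (· ∈ Q)).length ≤ Q.card := by
      rw [← List.toFinset_card_of_nodup (hl.filter _)]
      exact Finset.card_le_card fun x hx => by simp at hx; exact hx.2
    omega
  clear hl
  induction l with
  | nil => simp [prune]
  | cons x l ih =>
    by_cases h1 : x ∈ Q
    · have : prune Q (x :: l) = x :: prune Q l := by simp [prune, h1]
      rw [this]
      simp only [List.filter_cons, h1, decide_true, if_true, List.length_cons]
      split_ifs at ih ⊢ <;> omega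
    · have hf : (x :: l).filter (· ∈ Q) = l.filter (· ∈ Q) := by simp [h1]
      rw [hf]
      by_cases h2 : x.isLeft ∧ ∃ a l', prune Q l = .inr a :: l'
      · have : prune Q (x :: l) = x :: prune Q l := by simp [prune, h1, h2]
        rw [this, if_neg]
        · rw [if_pos h2.2] at ih
          simpa using ih
        · rintro ⟨a, l', h⟩
          rcases x with i | b
          · simp at h
          · simp at h2
      · have : prune Q (x :: l) = prune Q l := by
          rw [prune, if_neg h1, if_neg h2]
        rw [this]
        exact ih

end

/-! ### Counting indistinguishable inputs by a potential -/

section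
variable {S n : ℕ}

theorem exists_cut (key : Rec S n → ℝ) (s : Rec S n) (l : List (Rec S n))
    (hl : l.Pairwise fun x y => key x < key y) (hs : ∀ x ∈ l, key x ≠ key s) :
    ∃ l₁ l₂, l = l₁ ++ l₂ ∧ (∀ x ∈ l₁, key x < key s) ∧ ∀ x ∈ l₂, key s < key x := by
  induction l with
  | nil => exact ⟨[], [], by simp⟩
  | cons y l ih =>
    rw [List.pairwise_cons] at hl
    rcases lt_or_gt_of_ne (hs y (by simp)) with h | h
    · obtain ⟨l₁, l₂, rfl, h₁, h₂⟩ := ih hl.2 fun x hx => hs x (by simp [hx])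
      refine ⟨y :: l₁, l₂, rfl, ?_, h₂⟩
      rintro x hx
      rcases List.mem_cons.1 hx with rfl | hx
      exacts [h, h₁ x hx]
    · refine ⟨[], y :: l, rfl, by simp, ?_⟩
      rintro x hx
      rcases List.mem_cons.1 hx with rfl | hx
      exacts [h, h.trans (hl.1 x hx)]

theorem pairwise_insert {key : Rec S n → ℝ} {s : Rec S n} {l₁ l₂ : List (Rec S n)}
    (hl : (l₁ ++ l₂).Pairwise fun x y => key x < key y) (h₁ : ∀ x ∈ l₁, key x < key s)
    (h₂ : ∀ x ∈ l₂, key s < key x) :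
    (l₁ ++ s :: l₂).Pairwise fun x y => key x < key y := by
  rw [List.pairwise_append] at hl ⊢
  refine ⟨hl.1, List.pairwise_cons.2 ⟨h₂, hl.2.1⟩, fun x hx y hy => ?_⟩
  rcases List.mem_cons.1 hy with rfl | hy
  exacts [h₁ x hx, hl.2.2 x hx y hy]

/-- Two records in a list that is sorted for both keys compare alike. -/
theorem lt_iff_of_pairwise {key key' : Rec S n → ℝ} {l : List (Rec S n)}
    (h : l.Pairwise fun x y => key x < key y) (h' : l.Pairwise fun x y => key' x < key' y)
    {x y : Rec S n} (hx : x ∈ l) (hy : y ∈ l) : key x < key y ↔ key' x < key' y := by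
  induction l with
  | nil => simp at hx
  | cons z l ih =>
    rw [List.pairwise_cons] at h h'
    rcases List.mem_cons.1 hx with hxz | hx' <;> rcases List.mem_cons.1 hy with hyz | hy'
    · simp [hxz, hyz]
    · subst hxz
      exact ⟨fun _ => h'.1 y hy', fun _ => h.1 y hy'⟩
    · subst hyz
      exact ⟨fun hh => absurd hh (h.1 x hx').not_gt, fun hh => absurd hh (h'.1 x hx').not_gt⟩
    · exact ih h.2 h'.2 hx' hy'

open Classical in
/-- The number of pieces in memory of records outside the list `l`. -/
noncomputable def excess (mem : Finset (Piece S n)) (l : List (Rec S n)) : ℕ :=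
  (mem.filter fun p => p.1 ∉ l).card

/-- The records in `l` are in sorted order for all the inputs in `F`, and `l` contains the small
records and the complete large records in memory. -/
structure Knows (w : ℕ) (mem : Finset (Piece S n)) (l : List (Rec S n))
    (F : Finset (Fin n → Fin (S + 1))) : Prop where
  small : ∀ p ∈ mem, ∀ i, p.1 = .inl i → p.1 ∈ l
  large : ∀ a, pieces w (.inr a) ⊆ mem → .inr a ∈ l
  sorted : ∀ f ∈ F, l.Pairwise fun x y => cfgKey f x < cfgKey f y

/-- The potential of a state: it bounds, up to a factor `R` for each piece yet to be read, the
number of inputs that can still be told apart. -/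
noncomputable def potential (R : ℝ) (mem : Finset (Piece S n)) (l : List (Rec S n)) : ℝ :=
  runWeight 0 l * R ^ excess mem l

theorem potential_nonneg {R : ℝ} (hR : 0 ≤ R) (mem : Finset (Piece S n)) (l : List (Rec S n)) :
    0 ≤ potential R mem l := by unfold potential; positivity

theorem excess_insert_le (p : Piece S n) (mem : Finset (Piece S n)) (l : List (Rec S n)) :
    excess (insert p mem) l ≤ excess mem l + 1 := by
  classical
  unfold excess
  rw [Finset.filter_insert]
  split_ifs
  · exact Nat.le_succ _
  · exact Finset.card_insert_le p _

theorem excess_insert_of_mem {p : Piece S n} {l : List (Rec S n)} (hp : p.1 ∈ l)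
    (mem : Finset (Piece S n)) : excess (insert p mem) l = excess mem l := by
  classical
  unfold excess
  rw [Finset.filter_insert, if_neg (by simpa using hp)]

theorem card_pieces (w : ℕ) (r : Rec S n) : (pieces w r).card = size w r := by
  unfold pieces
  rw [Finset.card_image_of_injective _ fun a b h => (Prod.mk.inj h).2, Finset.card_range]

theorem Knows.anti {w : ℕ} {mem mem' : Finset (Piece S n)} {l : List (Rec S n)}
    {F : Finset (Fin n → Fin (S + 1))} (h : Knows w mem l F) (hm : mem' ⊆ mem) :
    Knows w mem' l F :=
  ⟨fun p hp => h.small p (hm hp), fun a ha => h.large a (ha.trans hm), h.sorted⟩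

/-- Reading the small record `s` while knowing `l`. -/
theorem card_le_of_insert_small {w : ℕ} {R K : ℝ} (hR : 4 ≤ R) (hK : 0 ≤ K) {s : Fin S} {t : ℕ}
    {mem : Finset (Piece S n)} {l : List (Rec S n)} {F : Finset (Fin n → Fin (S + 1))}
    (hk : Knows w mem l F) (hs : Sum.inl s ∉ l)
    (H : ∀ l' F', F' ⊆ F → Knows w (insert (.inl s, t) mem) l' F' →
      (F'.card : ℝ) ≤ K * potential R (insert (.inl s, t) mem) l') :
    (F.card : ℝ) ≤ K * R * potential R mem l := by
  classical
  rcases F.eq_empty_or_nonempty with rfl | ⟨f₀, hf₀⟩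
  · have := potential_nonneg (by linarith : 0 ≤ R) mem l
    simp only [Finset.card_empty, Nat.cast_zero]
    positivity
  obtain ⟨X, r, Y, α, hl, hr, hw, hX, hY⟩ := exists_run s l hs (by
    refine (hk.sorted f₀ hf₀).imp ?_
    rintro x y hxy i j rfl rfl
    exact (cfgKey_small_lt_small f₀ i j).1 hxy)
  let L : ℕ → List (Rec S n) := fun j => X ++ ((r.take j ++ .inl s :: r.drop j) ++ Y)
  have hL : ∀ j x, x ∈ L j ↔ x = .inl s ∨ x ∈ l := by
    intro j x
    have : x ∈ r ↔ x ∈ r.take j ∨ x ∈ r.drop j := by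
      rw [← List.mem_append, List.take_append_drop]
    simp only [L, hl, List.mem_append, List.mem_cons, this]
    tauto
  -- Every input in `F` puts `s` at some place `j` of the run `r`: the small records that delimit
  -- the run, if any, fix its order with `X` and `Y`.
  have hcover : F ⊆ (Finset.range (r.length + 1)).biUnion fun j =>
      F.filter fun f => (L j).Pairwise fun x y => cfgKey f x < cfgKey f y := by
    intro f hf
    have hsort := hk.sorted f hf
    rw [hl] at hsort
    have hinj : ∀ x ∈ l, cfgKey f x ≠ cfgKey f (.inl s) := fun x hx he =>
      hs ((isInput_cfgKey f).distinct he ▸ hx)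
    have hsort' := hsort
    rw [List.pairwise_append, List.pairwise_append] at hsort'
    obtain ⟨l₁, l₂, h12, h₁, h₂⟩ := exists_cut (cfgKey f) (.inl s) r hsort'.2.1.1
      fun x hx => hinj x (by simp [hl, hx])
    simp only [Finset.mem_biUnion, Finset.mem_filter, Finset.mem_range]
    refine ⟨l₁.length, by simp [h12], hf, ?_⟩
    have : L l₁.length = (X ++ l₁) ++ .inl s :: (l₂ ++ Y) := by simp [L, h12]
    rw [this]
    refine pairwise_insert (by simpa [h12] using hsort) ?_ ?_
    · intro x hx
      rcases List.mem_append.1 hx with hx | hx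
      · rcases hX with rfl | ⟨X', i, rfl, hi⟩
        · simp at hx
        · have hi' := (cfgKey_small_lt_small f i s).2 hi
          rcases List.mem_append.1 hx with hx | hx
          · exact ((List.pairwise_append.1 hsort'.1).2.2 x hx _ (by simp)).trans hi'
          · rw [List.mem_singleton] at hx
            exact hx ▸ hi'
      · exact h₁ x hx
    · intro x hx
      rcases List.mem_append.1 hx with hx | hx
      · exact h₂ x hx
      · rcases hY with rfl | ⟨Y', i, rfl, hi⟩
        · simp at hx
        · have hi' := (cfgKey_small_lt_small f s i).2 hi
          rcases List.mem_cons.1 hx with rfl | hx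
          · exact hi'
          · exact hi'.trans ((List.pairwise_cons.1 hsort'.2.1.2.1).1 x hx)
  have hexc : ∀ j, excess (insert (.inl s, t) mem) (L j) ≤ excess mem l := by
    intro j
    rw [excess_insert_of_mem (by simp [hL])]
    refine Finset.card_le_card fun p hp => ?_
    simp only [Finset.mem_filter, hL, not_or] at hp ⊢
    exact ⟨hp.1, hp.2.2⟩
  have hbound : ∀ j ∈ Finset.range (r.length + 1),
      ((F.filter fun f => (L j).Pairwise fun x y => cfgKey f x < cfgKey f y).card : ℝ)
        ≤ K * R ^ excess mem l * α * (catalan j * catalan (r.length - j) : ℕ) := by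
    intro j hj
    have hj' : j ≤ r.length := by simpa [Nat.lt_succ_iff] using hj
    refine (H (L j) _ (Finset.filter_subset _ _) ⟨?_, ?_,
      fun f hf => (Finset.mem_filter.1 hf).2⟩).trans ?_
    · intro p hp i hi
      rw [hL]
      rcases Finset.mem_insert.1 hp with rfl | hp
      · exact Or.inl rfl
      · exact Or.inr (hk.small p hp i hi)
    · intro a ha
      rw [hL]
      refine Or.inr (hk.large a fun p hp => ?_)
      rcases Finset.mem_insert.1 (ha hp) with rfl | h
      · simp [pieces] at hp
      · exact h
    · have hwt : runWeight 0 (L j) = α * (catalan j * catalan (r.length - j)) := by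
        simp only [L]
        rw [hw, runWeight_append_small, runWeight_large_run, runWeight_large_run]
        · simp [hj']
        · exact fun x hx => hr x (List.mem_of_mem_drop hx)
        · exact fun x hx => hr x (List.mem_of_mem_take hx)
      unfold potential
      rw [hwt, Nat.cast_mul]
      have : R ^ excess (insert (.inl s, t) mem) (L j) ≤ R ^ excess mem l :=
        pow_le_pow_right₀ (by linarith) (hexc j)
      calc K * ((α : ℝ) * (catalan j * catalan (r.length - j) : ℕ)
            * R ^ excess (insert (.inl s, t) mem) (L j))
          ≤ K * ((α : ℝ) * (catalan j * catalan (r.length - j) : ℕ) * R ^ excess mem l) := by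
            gcongr
        _ = _ := by ring
  -- The Catalan convolution: summing over all splits of the run costs a factor 4 instead of its
  -- number of places.
  have hsum : ∑ j ∈ Finset.range (r.length + 1), catalan j * catalan (r.length - j)
      ≤ 4 * catalan r.length := by
    rw [Finset.sum_range (f := fun j => catalan j * catalan (r.length - j)), ← catalan_succ]
    exact catalan_succ_le _
  have hl0 : runWeight 0 l = α * catalan r.length := by
    rw [hl, hw, runWeight_large_run r hr, Nat.zero_add]
  calc (F.card : ℝ) ≤ ∑ j ∈ Finset.range (r.length + 1),
        ((F.filter fun f => (L j).Pairwise fun x y => cfgKey f x < cfgKey f y).card : ℝ) := by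
        exact_mod_cast (Finset.card_le_card hcover).trans Finset.card_biUnion_le
    _ ≤ ∑ j ∈ Finset.range (r.length + 1),
        K * R ^ excess mem l * α * (catalan j * catalan (r.length - j) : ℕ) :=
        Finset.sum_le_sum hbound
    _ = K * R ^ excess mem l * α *
        (∑ j ∈ Finset.range (r.length + 1), catalan j * catalan (r.length - j) : ℕ) := by
        rw [← Finset.mul_sum, Nat.cast_sum]
    _ ≤ K * R ^ excess mem l * α * (4 * catalan r.length : ℕ) := by
        gcongr
    _ = K * 4 * potential R mem l := by
        unfold potential
        rw [hl0]
        push_cast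
        ring
    _ ≤ K * R * potential R mem l := by
        have := potential_nonneg (by linarith : 0 ≤ R) mem l
        gcongr

/-- Completing the large record `a` while knowing `l`. -/
theorem card_le_of_insert_large {w M : ℕ} {R K : ℝ} (hR : 4 ≤ R) (hK : 0 ≤ K)
    (hRw : 4 * (2 * M + 1) ≤ R ^ w) {a : Fin n} {t : ℕ}
    {mem : Finset (Piece S n)} {l : List (Rec S n)} {F : Finset (Fin n → Fin (S + 1))}
    (hk : Knows w mem l F) (hp : (.inr a, t) ∉ mem) (ha : Sum.inr a ∉ l)
    (hfull : pieces w (.inr a) ⊆ insert (.inr a, t) mem) (hM : mem.card ≤ M)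
    (H : ∀ l' F', F' ⊆ F → Knows w (insert (.inr a, t) mem) l' F' →
      (F'.card : ℝ) ≤ K * potential R (insert (.inr a, t) mem) l') :
    (F.card : ℝ) ≤ K * R * potential R mem l := by
  classical
  rcases F.eq_empty_or_nonempty with rfl | ⟨f₀, hf₀⟩
  · have := potential_nonneg (by linarith : 0 ≤ R) mem l
    simp only [Finset.card_empty, Nat.cast_zero]
    positivity
  -- `Q` also contains the records that are only partly in memory, so pruning discards none that has
  -- a piece there and cannot raise the excess.
  set Q := mem.image Prod.fst with hQ
  set q := prune Q l with hq
  have hqmem : ∀ p ∈ mem, (p.1 ∈ q ↔ p.1 ∈ l) := fun p hp =>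
    mem_prune (Finset.mem_image_of_mem _ hp) l
  have hqlen : q.length ≤ 2 * M := by
    refine (length_prune_le Q l ((hk.sorted f₀ hf₀).imp ?_)).trans ?_
    · rintro x y h rfl
      exact h.false
    · have : Q.card ≤ mem.card := Finset.card_image_le
      omega
  let L : ℕ → List (Rec S n) := fun j => q.take j ++ .inr a :: q.drop j
  have hL : ∀ j x, x ∈ L j ↔ x = .inr a ∨ x ∈ q := by
    intro j x
    have : x ∈ q ↔ x ∈ q.take j ∨ x ∈ q.drop j := by
      rw [← List.mem_append, List.take_append_drop]
    simp only [L, List.mem_append, List.mem_cons, this]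
    tauto
  have hcover : F ⊆ (Finset.range (q.length + 1)).biUnion fun j =>
      F.filter fun f => (L j).Pairwise fun x y => cfgKey f x < cfgKey f y := by
    intro f hf
    have hsort := (hk.sorted f hf).sublist (prune_sublist Q l)
    obtain ⟨l₁, l₂, h12, h₁, h₂⟩ := exists_cut (cfgKey f) (.inr a) q hsort
      fun x hx he => ha ((isInput_cfgKey f).distinct he ▸ (prune_sublist Q l).subset hx)
    simp only [Finset.mem_biUnion, Finset.mem_filter, Finset.mem_range]
    refine ⟨l₁.length, by simp [h12], hf, ?_⟩
    have : L l₁.length = l₁ ++ .inr a :: l₂ := by simp [L, h12]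
    rw [this]
    exact pairwise_insert (h12 ▸ hsort) h₁ h₂
  -- The last piece would add 1 to the excess, but once `a` is in the list all its `w` pieces stop
  -- counting.
  have hexc : ∀ j, excess (insert (.inr a, t) mem) (L j) + w ≤ excess mem l + 1 := by
    intro j
    have h1 : excess (insert (.inr a, t) mem) l = excess mem l + 1 := by
      unfold excess
      rw [Finset.filter_insert, if_pos ha, Finset.card_insert_of_notMem (by simp [hp])]
    rw [← h1, ← show (pieces w (.inr a : Rec S n)).card = w from card_pieces w _]
    unfold excess
    rw [← Finset.card_union_of_disjoint]
    · refine Finset.card_le_card fun p hp' => ?_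
      rcases Finset.mem_union.1 hp' with h | h
      · simp only [Finset.mem_filter, hL, not_or] at h ⊢
        refine ⟨h.1, fun hpl => h.2.2 ?_⟩
        rcases Finset.mem_insert.1 h.1 with rfl | h'
        · exact absurd rfl h.2.1
        · exact (hqmem p h').2 hpl
      · refine Finset.mem_filter.2 ⟨hfull h, ?_⟩
        simp only [pieces, Finset.mem_image] at h
        obtain ⟨u, -, rfl⟩ := h
        exact ha
    · rw [Finset.disjoint_left]
      intro p h h'
      simp only [Finset.mem_filter, hL, not_or] at h
      simp only [pieces, Finset.mem_image] at h'
      obtain ⟨u, -, rfl⟩ := h'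
      exact h.2.1 rfl
  have hR0 : (0 : ℝ) < R := by linarith
  have hbound : ∀ j ∈ Finset.range (q.length + 1),
      ((F.filter fun f => (L j).Pairwise fun x y => cfgKey f x < cfgKey f y).card : ℝ) * R ^ w
        ≤ K * R * (4 * potential R mem l) := by
    intro j hj
    have hcard := H (L j) (F.filter fun f => (L j).Pairwise fun x y => cfgKey f x < cfgKey f y)
      (Finset.filter_subset _ _) ⟨?_, ?_, fun f hf => (Finset.mem_filter.1 hf).2⟩
    · have hwt : runWeight 0 (L j) ≤ 4 * runWeight 0 l := by
        refine (runWeight_insert_large a _ _ 0).trans ?_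
        rw [List.take_append_drop]
        exact Nat.mul_le_mul_left _ (runWeight_prune_le Q l 0)
      have hwt' : (runWeight 0 (L j) : ℝ) ≤ 4 * runWeight 0 l := by exact_mod_cast hwt
      have hpow : R ^ excess (insert (.inr a, t) mem) (L j) * R ^ w ≤ R ^ excess mem l * R := by
        rw [← pow_add, ← pow_succ]
        exact pow_le_pow_right₀ (by linarith) (hexc j)
      unfold potential at hcard ⊢
      calc _ ≤ K * (runWeight 0 (L j) * R ^ excess (insert (.inr a, t) mem) (L j)) * R ^ w := by
            gcongr
        _ = K * runWeight 0 (L j) * (R ^ excess (insert (.inr a, t) mem) (L j) * R ^ w) := by ring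
        _ ≤ K * (4 * runWeight 0 l) * (R ^ excess mem l * R) := by gcongr
        _ = _ := by ring
    · intro p hp i hi
      rw [hL]
      rcases Finset.mem_insert.1 hp with rfl | hp
      · exact Or.inl rfl
      · exact Or.inr ((hqmem p hp).2 (hk.small p hp i hi))
    · intro b hb
      rw [hL]
      by_cases hba : b = a
      · exact Or.inl (by rw [hba])
      · refine Or.inr ?_
        have hsub : pieces w (.inr b) ⊆ mem := fun p hp => by
          rcases Finset.mem_insert.1 (hb hp) with rfl | h
          · simp [pieces] at hp
            exact absurd hp.2 hba
          · exact h
        -- A piece of `b` witnesses that pruning kept `b`. With `w = 0` there is none, but then `a`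
        -- would already be in `l`.
        by_cases hw : 0 < w
        · exact (hqmem (.inr b, 0) (hsub (by simp [pieces, size, hw]))).2 (hk.large b hsub)
        · exact absurd (hk.large a (by simp [pieces, size, Nat.eq_zero_of_not_pos hw])) ha
  have hP := potential_nonneg hR0.le mem l
  have hlen : ((q.length + 1 : ℕ) : ℝ) ≤ 2 * M + 1 := by exact_mod_cast Nat.succ_le_succ hqlen
  have htot : (F.card : ℝ) * R ^ w ≤ (2 * M + 1) * (K * R * (4 * potential R mem l)) := by
    calc (F.card : ℝ) * R ^ w ≤ (∑ j ∈ Finset.range (q.length + 1),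
        ((F.filter fun f => (L j).Pairwise fun x y => cfgKey f x < cfgKey f y).card : ℝ))
          * R ^ w := by
          gcongr
          exact_mod_cast (Finset.card_le_card hcover).trans Finset.card_biUnion_le
      _ ≤ ∑ _j ∈ Finset.range (q.length + 1), K * R * (4 * potential R mem l) := by
          rw [Finset.sum_mul]
          exact Finset.sum_le_sum hbound
      _ = (q.length + 1 : ℕ) * (K * R * (4 * potential R mem l)) := by
          rw [Finset.sum_const, Finset.card_range, nsmul_eq_mul]
      _ ≤ _ := by gcongr
  have hRwpos : 0 < R ^ w := by positivity
  refine le_of_mul_le_mul_right ?_ hRwpos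
  calc (F.card : ℝ) * R ^ w ≤ _ := htot
    _ = K * R * potential R mem l * (4 * (2 * M + 1)) := by ring
    _ ≤ _ := by gcongr

/-- Reading one piece multiplies the number of inputs that can be told apart by at most `R`. -/
theorem card_le_of_insert {w M : ℕ} {R K : ℝ} (hR : 4 ≤ R) (hK : 0 ≤ K)
    (hRw : 4 * (2 * M + 1) ≤ R ^ w) {p : Piece S n}
    {mem : Finset (Piece S n)} {l : List (Rec S n)} {F : Finset (Fin n → Fin (S + 1))}
    (hk : Knows w mem l F) (hM : mem.card ≤ M)
    (H : ∀ l' F', F' ⊆ F → Knows w (insert p mem) l' F' →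
      (F'.card : ℝ) ≤ K * potential R (insert p mem) l') :
    (F.card : ℝ) ≤ K * R * potential R mem l := by
  classical
  have hR0 : (0 : ℝ) < R := by linarith
  have stay : Knows w (insert p mem) l F → (F.card : ℝ) ≤ K * R * potential R mem l := by
    intro hk'
    refine (H l F subset_rfl hk').trans ?_
    unfold potential
    calc K * (runWeight 0 l * R ^ excess (insert p mem) l)
        ≤ K * (runWeight 0 l * R ^ (excess mem l + 1)) := by
          gcongr
          · linarith
          · exact excess_insert_le p mem l
      _ = _ := by ring
  by_cases hp : p ∈ mem
  · exact stay (by rwa [Finset.insert_eq_of_mem hp])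
  obtain ⟨s | a, t⟩ := p
  · by_cases hs : Sum.inl s ∈ l
    · refine stay ⟨?_, ?_, hk.sorted⟩
      · intro p hp i hi
        rcases Finset.mem_insert.1 hp with rfl | hp
        exacts [hs, hk.small p hp i hi]
      · intro a ha
        refine hk.large a fun p hp => ?_
        rcases Finset.mem_insert.1 (ha hp) with rfl | h
        · simp [pieces] at hp
        · exact h
    · exact card_le_of_insert_small hR hK hk hs H
  · have hsmall : ∀ p ∈ insert (.inr a, t) mem, ∀ i, p.1 = .inl i → p.1 ∈ l := by
      intro p hp i hi
      rcases Finset.mem_insert.1 hp with rfl | hp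
      · simp at hi
      · exact hk.small p hp i hi
    by_cases ha : Sum.inr a ∈ l
    · refine stay ⟨hsmall, ?_, hk.sorted⟩
      intro b hb
      by_cases hba : b = a
      · rwa [hba]
      refine hk.large b fun p hp => ?_
      rcases Finset.mem_insert.1 (hb hp) with rfl | h
      · simp [pieces] at hp
        exact absurd hp.2 hba
      · exact h
    · by_cases hfull : pieces w (.inr a) ⊆ insert (.inr a, t) mem
      · exact card_le_of_insert_large hR hK hRw hk hp ha hfull hM H
      · refine stay ⟨hsmall, ?_, hk.sorted⟩
        intro b hb
        by_cases hba : b = a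
        · exact absurd (hba ▸ hb) hfull
        refine hk.large b fun p hp => ?_
        rcases Finset.mem_insert.1 (hb hp) with rfl | h
        · simp [pieces] at hp
          exact absurd hp.2 hba
        · exact h

/-- A block is read piece by piece. `K` stands for the bound on the rest of the run and is
generalized so that it can absorb a factor `R` at each step. -/
theorem card_le_of_union {w M : ℕ} {R : ℝ} (hR : 4 ≤ R)
    (hRw : 4 * (2 * M + 1) ≤ R ^ w) (D : Finset (Piece S n)) : ∀ {K : ℝ}, 0 ≤ K →
    ∀ {mem : Finset (Piece S n)} {l : List (Rec S n)} {F : Finset (Fin n → Fin (S + 1))},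
    Knows w mem l F → (mem ∪ D).card ≤ M →
    (∀ l' F', F' ⊆ F → Knows w (mem ∪ D) l' F' →
      (F'.card : ℝ) ≤ K * potential R (mem ∪ D) l') →
    (F.card : ℝ) ≤ K * R ^ D.card * potential R mem l := by
  classical
  induction D using Finset.induction_on with
  | empty =>
    intro K hK mem l F hk hM H
    simpa using H l F subset_rfl (by simpa using hk)
  | insert p D hp ih =>
    intro K hK mem l F hk hM H
    have hu : mem ∪ insert p D = insert p mem ∪ D := by
      rw [Finset.union_insert, Finset.insert_union]
    rw [hu] at hM H
    rw [Finset.card_insert_of_notMem hp, pow_succ, ← mul_assoc]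
    refine card_le_of_insert (p := p) hR (by positivity) hRw hk ((Finset.card_le_card ?_).trans hM) ?_
    · exact (Finset.subset_insert p mem).trans Finset.subset_union_left
    · intro l' F' hF' hk'
      exact ih hK hk' hM fun l'' F'' hF'' hk'' => H l'' F'' (hF''.trans hF') hk''

/-! ### The information bound along a whole run -/

theorem card_blockPieces_le (B : ℕ) (d : Disk S n) (b : ℕ) : (blockPieces B d b).card ≤ B := by
  unfold blockPieces
  refine (Finset.card_biUnion_le_card_mul _ _ 1 fun t _ => ?_).trans (by simp)
  cases d (b * B + t) <;> simp

theorem map_charge {x : Option (Outcome S n)} {o : Outcome S n}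
    (h : x.map Outcome.charge = some o) :
    ∃ o', x = some o' ∧ o'.disk = o.disk ∧ o'.loc = o.loc ∧ o.transfers = o'.transfers + 1 := by
  obtain ⟨o', h1, rfl⟩ := Option.map_eq_some_iff.1 h
  exact ⟨o', h1, rfl, rfl, rfl⟩

theorem IsPlacement.congr {w : ℕ} {key : Rec S n → ℝ} {o o' : Outcome S n}
    (h : IsPlacement w key o) (hd : o'.disk = o.disk) (hl : o'.loc = o.loc) :
    IsPlacement w key o' := by
  obtain ⟨h1, h2, h3, h4, h5⟩ := h
  constructor <;> simpa only [hd, hl]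

/-- The number of inputs that an algorithm can place within `T` transfers. -/
theorem card_le_of_run {B M w : ℕ} {R : ℝ} (hR : 4 ≤ R) (hRw : 4 * (2 * M + 1) ≤ R ^ w)
    (A : Algorithm S n) :
    ∀ (T : ℕ) (mem : Finset (Piece S n)) (d : Disk S n) (F : Finset (Fin n → Fin (S + 1)))
      (l : List (Rec S n)), mem.card ≤ M → Knows w mem l F →
      (∀ f ∈ F, ∃ o, run B M w (cfgKey f) A mem d = some o ∧ IsPlacement w (cfgKey f) o ∧
        o.transfers ≤ T) →
      (F.card : ℝ) ≤ R ^ (B * T) * potential R mem l := by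
  classical
  have hR0 : (0 : ℝ) < R := by linarith
  have hR1 : (1 : ℝ) ≤ R := by linarith
  induction A with
  | done loc =>
    intro T mem d F l hM hk hrun
    -- All inputs in `F` have reached the same disk and addresses, and these determine the input.
    have h1 : F.card ≤ 1 := Finset.card_le_one.2 fun f hf f' hf' => by
      obtain ⟨o, ho, hp, -⟩ := hrun f hf
      obtain ⟨o', ho', hp', -⟩ := hrun f' hf'
      simp only [run, Option.some.injEq] at ho ho'
      subst ho ho'
      exact eq_of_isPlacement hp hp'
    have hpos : (1 : ℝ) ≤ runWeight 0 l := by exact_mod_cast runWeight_pos l 0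
    unfold potential
    calc (F.card : ℝ) ≤ 1 := by exact_mod_cast h1
      _ ≤ _ := one_le_mul_of_one_le_of_one_le (one_le_pow₀ hR1)
        (one_le_mul_of_one_le_of_one_le hpos (one_le_pow₀ hR1))
  | read b A ih =>
    intro T mem d F l hM hk hrun
    rcases F.eq_empty_or_nonempty with rfl | ⟨f₀, hf₀⟩
    · have := potential_nonneg hR0.le mem l
      simp only [Finset.card_empty, Nat.cast_zero]
      positivity
    have hfit : (mem ∪ blockPieces B d b).card ≤ M := by
      obtain ⟨o, ho, -⟩ := hrun f₀ hf₀
      by_contra hc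
      simp [run, hc] at ho
    have hrun' : ∀ f ∈ F, ∃ o, run B M w (cfgKey f) A (mem ∪ blockPieces B d b) d = some o ∧
        IsPlacement w (cfgKey f) o ∧ o.transfers + 1 ≤ T := by
      intro f hf
      obtain ⟨o, ho, hp, ht⟩ := hrun f hf
      simp only [run, if_pos hfit] at ho
      obtain ⟨o', ho', h1, h2, h3⟩ := map_charge ho
      exact ⟨o', ho', hp.congr h1 h2, h3 ▸ ht⟩
    obtain ⟨T, rfl⟩ : ∃ T', T = T' + 1 := by
      obtain ⟨o, -, -, h⟩ := hrun' f₀ hf₀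
      exact ⟨T - 1, by omega⟩
    have := card_le_of_union hR hRw (blockPieces B d b) (K := R ^ (B * T)) (by positivity) hk hfit
      fun l' F' hF' hk' => ih T _ d F' l' hfit hk' fun f hf => by
        obtain ⟨o, h1, h2, h3⟩ := hrun' f (hF' hf)
        exact ⟨o, h1, h2, by omega⟩
    refine this.trans ?_
    have hP := potential_nonneg hR0.le mem l
    rw [← pow_add]
    gcongr
    have := card_blockPieces_le B d b
    rw [mul_add]
    omega
  | write b c A ih =>
    intro T mem d F l hM hk hrun
    refine ih T mem (writeBlock B d b c) F l hM hk fun f hf => ?_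
    obtain ⟨o, ho, hp, ht⟩ := hrun f hf
    by_cases hc : ∀ t < B, ∀ p, c t = some p → p ∈ mem
    · simp only [run, if_pos hc] at ho
      obtain ⟨o', ho', h1, h2, h3⟩ := map_charge ho
      exact ⟨o', ho', hp.congr h1 h2, by omega⟩
    · simp only [run, if_neg hc] at ho
      simp at ho
  | keep P A ih =>
    intro T mem d F l hM hk hrun
    refine (ih T (mem ∩ P) d F l ((Finset.card_le_card Finset.inter_subset_left).trans hM)
      (hk.anti Finset.inter_subset_left) fun f hf => ?_).trans ?_
    · obtain ⟨o, ho, h⟩ := hrun f hf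
      exact ⟨o, by simpa only [run] using ho, h⟩
    · unfold potential
      gcongr
      exact Finset.card_le_card (Finset.filter_subset_filter _ Finset.inter_subset_left)
  | compare x y A A' ih ih' =>
    intro T mem d F l hM hk hrun
    rcases F.eq_empty_or_nonempty with rfl | ⟨f₀, hf₀⟩
    · have := potential_nonneg hR0.le mem l
      simp only [Finset.card_empty, Nat.cast_zero]
      positivity
    have hin : pieces w x ⊆ mem ∧ pieces w y ⊆ mem := by
      obtain ⟨o, ho, -⟩ := hrun f₀ hf₀
      by_contra hc
      simp only [run, if_neg hc] at ho
      simp at ho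
    have hlist : ∀ z : Rec S n, pieces w z ⊆ mem → z ∈ l := by
      rintro (i | a) hz
      · exact hk.small (.inl i, 0) (hz (by simp [pieces, size])) i rfl
      · exact hk.large a hz
    -- Both records are in the common sorted list, so the whole of `F` takes the same branch: the
    -- branching was already paid for when reading.
    have hcmp : ∀ f ∈ F, (cfgKey f x < cfgKey f y ↔ cfgKey f₀ x < cfgKey f₀ y) := fun f hf =>
      lt_iff_of_pairwise (hk.sorted f hf) (hk.sorted f₀ hf₀) (hlist x hin.1) (hlist y hin.2)
    by_cases h0 : cfgKey f₀ x < cfgKey f₀ y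
    · refine ih T mem d F l hM hk fun f hf => ?_
      obtain ⟨o, ho, h⟩ := hrun f hf
      exact ⟨o, by simpa only [run, if_pos hin, if_pos ((hcmp f hf).2 h0)] using ho, h⟩
    · refine ih' T mem d F l hM hk fun f hf => ?_
      obtain ⟨o, ho, h⟩ := hrun f hf
      exact ⟨o, by simpa only [run, if_pos hin, if_neg (mt (hcmp f hf).1 h0)] using ho, h⟩

end

/-! ### Volume that must be read or written -/

section
variable {S n : ℕ}

/-- A run depends only on the keys of the records that were read completely. -/
theorem exists_history {B M w : ℕ} {key : Rec S n → ℝ} (A : Algorithm S n) :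
    ∀ (mem H : Finset (Piece S n)) (d : Disk S n) (o : Outcome S n), mem ⊆ H →
      run B M w key A mem d = some o →
      ∃ H', H ⊆ H' ∧ H'.card ≤ H.card + B * o.transfers ∧
        ∀ key' : Rec S n → ℝ, (∀ x, pieces w x ⊆ H' → key' x = key x) →
          run B M w key' A mem d = some o := by
  classical
  induction A with
  | done loc =>
    intro mem H d o hm ho
    exact ⟨H, subset_rfl, by omega, fun key' _ => by simpa only [run] using ho⟩
  | read b A ih =>
    intro mem H d o hm ho
    by_cases hc : (mem ∪ blockPieces B d b).card ≤ M
    · simp only [run, if_pos hc] at ho ⊢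
      obtain ⟨o', ho', rfl⟩ := Option.map_eq_some_iff.1 ho
      obtain ⟨H', h1, h2, h3⟩ := ih _ (H ∪ blockPieces B d b) d o'
        (Finset.union_subset_union_left hm) ho'
      refine ⟨H', Finset.subset_union_left.trans h1, ?_, fun key' hk => by rw [h3 key' hk]; rfl⟩
      have := Finset.card_union_le H (blockPieces B d b)
      have := card_blockPieces_le B d b
      simp only [Outcome.charge, mul_add]
      omega
    · simp only [run, if_neg hc] at ho
      simp at ho
  | write b c A ih =>
    intro mem H d o hm ho
    by_cases hc : ∀ t < B, ∀ p, c t = some p → p ∈ mem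
    · simp only [run, if_pos hc] at ho ⊢
      obtain ⟨o', ho', rfl⟩ := Option.map_eq_some_iff.1 ho
      obtain ⟨H', h1, h2, h3⟩ := ih mem H _ o' hm ho'
      refine ⟨H', h1, ?_, fun key' hk => by rw [h3 key' hk]; rfl⟩
      simp only [Outcome.charge, mul_add]
      omega
    · simp only [run, if_neg hc] at ho
      simp at ho
  | keep P A ih =>
    intro mem H d o hm ho
    simp only [run] at ho ⊢
    exact ih _ H d o (Finset.inter_subset_left.trans hm) ho
  | compare x y A A' ih ih' =>
    intro mem H d o hm ho
    by_cases hin : pieces w x ⊆ mem ∧ pieces w y ⊆ mem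
    · simp only [run, if_pos hin] at ho ⊢
      by_cases h : key x < key y
      · rw [if_pos h] at ho
        obtain ⟨H', h1, h2, h3⟩ := ih mem H d o hm ho
        refine ⟨H', h1, h2, fun key' hk => ?_⟩
        rw [hk x (hin.1.trans (hm.trans h1)), hk y (hin.2.trans (hm.trans h1)), if_pos h]
        exact h3 key' hk
      · rw [if_neg h] at ho
        obtain ⟨H', h1, h2, h3⟩ := ih' mem H d o hm ho
        refine ⟨H', h1, h2, fun key' hk => ?_⟩
        rw [hk x (hin.1.trans (hm.trans h1)), hk y (hin.2.trans (hm.trans h1)), if_neg h]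
        exact h3 key' hk
    · simp only [run, if_neg hin] at ho
      simp at ho

/-- A run changes at most `B` cells of the disk per transfer. -/
theorem exists_written {B M w : ℕ} {key : Rec S n → ℝ} (hB : 0 < B) (A : Algorithm S n) :
    ∀ (mem : Finset (Piece S n)) (d : Disk S n) (o : Outcome S n),
      run B M w key A mem d = some o →
      ∃ W : Finset ℕ, W.card ≤ B * o.transfers ∧ ∀ a ∉ W, o.disk a = d a := by
  classical
  induction A with
  | done loc =>
    intro mem d o ho
    simp only [run, Option.some.injEq] at ho
    subst ho
    exact ⟨∅, by simp, fun _ _ => rfl⟩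
  | read b A ih =>
    intro mem d o ho
    by_cases hc : (mem ∪ blockPieces B d b).card ≤ M
    · simp only [run, if_pos hc] at ho
      obtain ⟨o', ho', rfl⟩ := Option.map_eq_some_iff.1 ho
      obtain ⟨W, h1, h2⟩ := ih _ d o' ho'
      exact ⟨W, h1.trans (Nat.mul_le_mul_left _ (Nat.le_succ _)), h2⟩
    · simp only [run, if_neg hc] at ho
      simp at ho
  | write b c A ih =>
    intro mem d o ho
    by_cases hc : ∀ t < B, ∀ p, c t = some p → p ∈ mem
    · simp only [run, if_pos hc] at ho
      obtain ⟨o', ho', rfl⟩ := Option.map_eq_some_iff.1 ho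
      obtain ⟨W, h1, h2⟩ := ih _ _ o' ho'
      refine ⟨W ∪ (Finset.range B).image fun t => b * B + t, ?_, ?_⟩
      · have h3 := Finset.card_union_le W ((Finset.range B).image fun t => b * B + t)
        have h4 : ((Finset.range B).image fun t => b * B + t).card ≤ B :=
          Finset.card_image_le.trans (by simp)
        simp only [Outcome.charge, mul_add]
        omega
      · intro a ha
        simp only [Finset.mem_union, not_or, Finset.mem_image, Finset.mem_range, not_exists,
          not_and] at ha
        refine (h2 a ha.1).trans ?_
        unfold writeBlock
        rw [if_neg]
        rintro rfl
        refine ha.2 (a % B) (Nat.mod_lt _ hB) ?_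
        rw [mul_comm]
        exact Nat.div_add_mod a B
    · simp only [run, if_neg hc] at ho
      simp at ho
  | keep P A ih =>
    intro mem d o ho
    simp only [run] at ho
    exact ih _ d o ho
  | compare x y A A' ih ih' =>
    intro mem d o ho
    by_cases hin : pieces w x ⊆ mem ∧ pieces w y ⊆ mem
    · simp only [run, if_pos hin] at ho
      split_ifs at ho
      · exact ih mem d o ho
      · exact ih' mem d o ho
    · simp only [run, if_neg hin] at ho
      simp at ho

/-- In a correct run, changing the stripes of large records that were never read completely must
not lead to another input with `k` stripes. -/
theorem exists_unread {B M w k T : ℕ} {A : Algorithm S n} (hA : SolvesWithin B M w k T A)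
    (f : Fin n → Fin (S + 1)) (hf : (Finset.univ.image f).card = k) :
    ∃ U : Finset (Fin n), (n - U.card) * w ≤ B * T ∧
      ∀ f' : Fin n → Fin (S + 1), (Finset.univ.image f').card = k → (∀ a ∉ U, f' a = f a) →
        f' = f := by
  classical
  obtain ⟨o, ho, hp, ht⟩ := hA _ (isInput_cfgKey f) (by rw [numStripes_cfgKey, hf])
  obtain ⟨H, -, hcard, hH⟩ := exists_history A ∅ ∅ _ o subset_rfl ho
  -- `U` consists of the large records never read completely. The others contribute `w` distinct
  -- pieces each to the history; changes within `U` leave the outcome the same, and an outcome fits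
  -- only one input.
  refine ⟨Finset.univ.filter fun a => ¬ pieces w (.inr a) ⊆ H, ?_, fun f' hf' hag => ?_⟩
  · have hc := Finset.card_compl (Finset.univ.filter fun a : Fin n => ¬ pieces w (.inr a) ⊆ H)
    rw [Fintype.card_fin] at hc
    rw [← hc]
    rw [Finset.card_empty, zero_add] at hcard
    refine le_trans ?_ (hcard.trans (Nat.mul_le_mul_left _ ht))
    rw [← Finset.card_range w, ← Finset.card_product, Finset.card_range]
    refine Finset.card_le_card_of_injOn (fun p => ((.inr p.1 : Rec S n), p.2)) ?_ ?_
    · rintro ⟨a, t⟩ h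
      simp only [Finset.coe_product, Set.mem_prod, Finset.mem_coe, Finset.mem_compl,
        Finset.mem_filter, Finset.mem_univ, true_and, not_not, Finset.mem_range] at h
      exact h.1 (by simp [pieces, size, h.2])
    · rintro ⟨a, t⟩ - ⟨b, u⟩ - h
      simpa using h
  · obtain ⟨o', ho', hp', -⟩ := hA _ (isInput_cfgKey f') (by rw [numStripes_cfgKey, hf'])
    rw [hH (cfgKey f')] at ho'
    · rw [Option.some.injEq] at ho'
      subst ho'
      exact eq_of_isPlacement hp' hp
    · rintro (i | a) hx
      · rfl
      · have : f' a = f a := hag a (by simpa using hx)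
        simp only [cfgKey, this]

theorem exists_card_image_eq {k : ℕ} (hk : 1 ≤ k) (hkn : k ≤ n) (hkS : k ≤ S + 1) :
    ∃ f : Fin n → Fin (S + 1), (Finset.univ.image f).card = k := by
  classical
  refine ⟨fun a => ⟨min a (k - 1), by omega⟩, ?_⟩
  have : Finset.univ.image (fun a : Fin n => (⟨min a (k - 1), by omega⟩ : Fin (S + 1)))
      = (Finset.univ : Finset (Fin k)).map (Fin.castLEEmb hkS) := by
    ext g
    simp only [Finset.mem_image, Finset.mem_univ, true_and, Finset.mem_map, Fin.ext_iff]
    constructor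
    · rintro ⟨a, h⟩
      exact ⟨⟨min a (k - 1), by omega⟩, h⟩
    · rintro ⟨c, h⟩
      refine ⟨⟨c, by omega⟩, ?_⟩
      simp at h ⊢
      omega
  rw [this, Finset.card_map, Finset.card_fin]

/-- With at least two stripes, all large records but one have to be read. -/
theorem pred_mul_le_of_two_le {B M w k T : ℕ} {A : Algorithm S n}
    (hA : SolvesWithin B M w k T A) (hk : 2 ≤ k) (hkn : k ≤ n) (hkS : k ≤ S + 1) :
    (n - 1) * w ≤ B * T := by
  classical
  obtain ⟨f, hf⟩ := exists_card_image_eq (by omega) hkn hkS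
  obtain ⟨U, hU, hchange⟩ := exists_unread hA f hf
  refine le_trans (Nat.mul_le_mul_right _ ?_) hU
  suffices U.card ≤ 1 by omega
  refine Finset.card_le_one.2 fun a ha b hb => ?_
  by_contra hab
  by_cases hfab : f a = f b
  -- If `a` and `b` share a stripe, move `a` to another existing stripe; `b` keeps the old one
  -- nonempty, so the number of stripes is unchanged.
  · obtain ⟨g, hg, hga⟩ := Finset.exists_mem_ne (by omega : 1 < (Finset.univ.image f).card) (f a)
    have himg : Finset.univ.image (Function.update f a g) = Finset.univ.image f := by
      obtain ⟨c, -, rfl⟩ := Finset.mem_image.1 hg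
      have hca : c ≠ a := fun h => hga (by rw [h])
      ext x
      simp only [Finset.mem_image, Finset.mem_univ, true_and]
      constructor
      · rintro ⟨e, rfl⟩
        by_cases hea : e = a
        · exact ⟨c, by simp [hea]⟩
        · exact ⟨e, by simp [hea]⟩
      · rintro ⟨e, rfl⟩
        by_cases hea : e = a
        · refine ⟨b, ?_⟩
          rw [Function.update_of_ne (Ne.symm hab), hea, hfab]
        · exact ⟨e, by simp [hea]⟩
    have := hchange (Function.update f a g) (by rw [himg, hf]) fun e he =>
      Function.update_of_ne (by rintro rfl; exact he ha) _ _
    exact hga (by rw [← this]; simp)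
  -- If they lie in different stripes, exchange them.
  · have himg : Finset.univ.image (f ∘ Equiv.swap a b) = Finset.univ.image f := by
      rw [← Finset.image_image, Finset.image_univ_equiv]
    have := hchange (f ∘ Equiv.swap a b) (by rw [himg, hf]) fun e he => by
      rw [Function.comp_apply, Equiv.swap_apply_of_ne_of_ne] <;> rintro rfl <;> contradiction
    have h2 := congrFun this a
    simp only [Function.comp_apply, Equiv.swap_apply_left] at h2
    exact hfab h2.symm

theorem card_image_const {m : ℕ} (hn : 1 ≤ n) (g : Fin m) :
    (Finset.univ.image fun _ : Fin n => g).card = 1 := by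
  have : Nonempty (Fin n) := ⟨⟨0, hn⟩⟩
  rw [Finset.image_const Finset.univ_nonempty, Finset.card_singleton]

/-- With one stripe, some large record has to be read. -/
theorem size_le_of_one_stripe {B M w T : ℕ} {A : Algorithm S n}
    (hA : SolvesWithin B M w 1 T A) (hS : 1 ≤ S) (hn : 1 ≤ n) : w ≤ B * T := by
  obtain ⟨U, hU, hchange⟩ := exists_unread hA (fun _ => 0) (card_image_const hn _)
  have hlt : U.card < n := by
    by_contra hc
    have hUu : U = Finset.univ :=
      Finset.eq_univ_of_card U (le_antisymm (Finset.card_le_univ U) (by simpa using hc))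
    have h2 := congrFun (hchange (fun _ => Fin.last S) (card_image_const hn _)
      (by simp [hUu])) ⟨0, hn⟩
    have := congrArg Fin.val h2
    simp at this
    omega
  exact (Nat.le_mul_of_pos_left w (by omega)).trans hU

/-- With one stripe, which comes first, the small or the large records have to be moved. -/
theorem volume_le_of_one_stripe {B M w T : ℕ} {A : Algorithm S n}
    (hA : SolvesWithin B M w 1 T A) (hB : 0 < B) (hn : 1 ≤ n) :
    S ≤ B * T ∨ n * w ≤ B * T := by
  classical
  obtain ⟨o, ho, hp, ht⟩ := hA (cfgKey fun _ : Fin n => (0 : Fin (S + 1))) (isInput_cfgKey _)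
    (by rw [numStripes_cfgKey, card_image_const hn])
  obtain ⟨W, hW, hd⟩ := exists_written hB A _ _ o ho
  have hWT : W.card ≤ B * T := hW.trans (Nat.mul_le_mul_left _ ht)
  by_cases hs : ∀ i : Fin S, o.loc (.inl i) ∈ W
  · left
    refine le_trans ?_ hWT
    rw [← Finset.card_fin S]
    refine Finset.card_le_card_of_injOn (fun i => o.loc (.inl i)) (fun i _ => hs i) ?_
    intro i _ j _ hij
    have h1 := hp.stored (.inl i) 0 (by simp [size])
    have h2 := hp.stored (.inl j) 0 (by simp [size])
    simp only [add_zero] at h1 h2 hij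
    rw [hij, h2] at h1
    simpa using h1.symm
  by_cases hl : ∀ a : Fin n, ∀ t < w, o.loc (.inr a) + t ∈ W
  · right
    refine le_trans ?_ hWT
    rw [← Finset.card_range w, ← Finset.card_fin n, ← Finset.card_product]
    refine Finset.card_le_card_of_injOn (fun p => o.loc (.inr p.1) + p.2) ?_ ?_
    · rintro ⟨a, t⟩ h
      exact hl a t (by simpa using h)
    · rintro ⟨a, t⟩ hat ⟨b, u⟩ hbu h
      have h1 := hp.stored (.inr a) t (by simpa [size] using hat)
      have h2 := hp.stored (.inr b) u (by simpa [size] using hbu)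
      simp only at h
      rw [h, h2] at h1
      simpa [eq_comm] using h1
  push Not at hs hl
  obtain ⟨i, hi⟩ := hs
  obtain ⟨a, t, htw, ha⟩ := hl
  have h1 := hp.stored (.inl i) 0 (by simp [size])
  rw [add_zero, hd _ hi] at h1
  have h2 := hp.stored (.inr a) t htw
  rw [hd _ ha] at h2
  -- With an untouched cell in each, record `i` is still at an address below `S`, while piece `t` of
  -- `a` is at least `t` cells past `S`, so `a` starts after `i`. But `a` is required to precede
  -- `i`.
  have hlt := hp.large_small a i ((cfgKey_large_lt_small _ i a).2 (by simp))
  unfold startDisk at h1 h2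
  split_ifs at h1 h2 with h3 h4 h5
  all_goals simp at h1 h2
  have h6 := Nat.div_add_mod (o.loc (.inr a) + t - S) w
  have h7 := h2.2
  omega

end

/-! ### Counting the inputs, and the final trade-off -/

theorem pow_le_descFactorial_sq {m k : ℕ} (h : k ≤ m) : m ^ k ≤ m.descFactorial k ^ 2 := by
  have h1 : m.descFactorial k = ∏ i ∈ Finset.range k, (m - i) :=
    Nat.descFactorial_eq_prod_range m k
  have h2 : m.descFactorial k = ∏ i ∈ Finset.range k, (m - (k - 1 - i)) := by
    rw [h1, Finset.prod_range_reflect (fun i => m - i)]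
  rw [sq]
  -- Pair each factor with its mirror image: `(m - i) * (m - (k - 1 - i)) ≥ m`, because both factors
  -- are positive and their sum is at least `m + 1`.
  nth_rewrite 1 [h1]
  rw [h2, ← Finset.prod_mul_distrib]
  calc m ^ k = ∏ _i ∈ Finset.range k, m := by simp
    _ ≤ _ := Finset.prod_le_prod' fun i hi => by
      have hi := Finset.mem_range.1 hi
      obtain ⟨x, hx⟩ : ∃ x, m - i = x + 1 := ⟨m - i - 1, by omega⟩
      obtain ⟨y, hy⟩ : ∃ y, m - (k - 1 - i) = y + 1 := ⟨m - (k - 1 - i) - 1, by omega⟩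
      rw [hx, hy]
      have : m ≤ x + y + 1 := by omega
      nlinarith

/-- The number of maps with an image of cardinality `k`. -/
theorem descFactorial_mul_pow_le (N k m : ℕ) :
    N.descFactorial k * k ^ m ≤
      (Finset.univ.filter fun f : Fin (k + m) → Fin N => (Finset.univ.image f).card = k).card := by
  classical
  have hcard : Fintype.card ((Fin k ↪ Fin N) × (Fin m → Fin k)) = N.descFactorial k * k ^ m := by
    simp [Fintype.card_embedding_eq]
  rw [← hcard, ← Finset.card_univ]
  -- The first `k` large records get distinct gaps; each of the other `m` joins one of their
  -- stripes.
  refine Finset.card_le_card_of_injOn (fun p => Fin.append p.1 (p.1 ∘ p.2)) ?_ ?_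
  · rintro ⟨e, h⟩ -
    simp only [Finset.coe_filter, Finset.mem_univ, true_and, Set.mem_ofPred_eq]
    have : Finset.univ.image (Fin.append (e : Fin k → Fin N) (e ∘ h)) = Finset.univ.map e := by
      ext x
      simp only [Finset.mem_image, Finset.mem_univ, true_and, Finset.mem_map]
      constructor
      · rintro ⟨a, rfl⟩
        refine Fin.addCases (fun i => ?_) (fun i => ?_) a
        · exact ⟨i, by simp⟩
        · exact ⟨h i, by simp⟩
      · rintro ⟨i, rfl⟩
        exact ⟨Fin.castAdd m i, by simp⟩
    rw [this, Finset.card_map, Finset.card_fin]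
  · rintro ⟨e, h⟩ - ⟨e', h'⟩ - heq
    have he : e = e' := by
      ext i
      have := congrFun heq (Fin.castAdd m i)
      simp only [Fin.append_left] at this
      rw [this]
    subst he
    congr 1
    funext i
    have := congrFun heq (Fin.natAdd k i)
    simpa only [Fin.append_right, Function.comp_apply, EmbeddingLike.apply_eq_iff_eq] using this

theorem four_mul_logb_card_ge {S n k : ℕ} (hS : 1 ≤ S) (hk : 1 ≤ k) (hkn : k ≤ n)
    (hkS : k ≤ S + 1) :
    k * Real.logb 2 S + n * Real.logb 2 k ≤ 4 * Real.logb 2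
      ((Finset.univ.filter fun f : Fin n → Fin (S + 1) =>
        (Finset.univ.image f).card = k).card : ℝ) := by
  obtain ⟨m, rfl⟩ := Nat.exists_eq_add_of_le hkn
  have hk0 : (0 : ℝ) < k := by exact_mod_cast hk
  have hS0 : (0 : ℝ) < S := by exact_mod_cast hS
  have hd0 : (0 : ℝ) < ((S + 1).descFactorial k : ℕ) := by
    exact_mod_cast Nat.descFactorial_pos.2 hkS
  have h1 : Real.logb 2 (((S + 1).descFactorial k * k ^ m : ℕ) : ℝ) ≤ Real.logb 2
      ((Finset.univ.filter fun f : Fin (k + m) → Fin (S + 1) =>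
        (Finset.univ.image f).card = k).card : ℝ) := by
    refine Real.logb_le_logb_of_le one_lt_two ?_ ?_
    · push_cast
      positivity
    · exact_mod_cast descFactorial_mul_pow_le (S + 1) k m
  have h2 : Real.logb 2 (((S + 1 : ℕ) : ℝ) ^ k) ≤
      Real.logb 2 ((((S + 1).descFactorial k : ℕ) : ℝ) ^ 2) := by
    refine Real.logb_le_logb_of_le one_lt_two (by positivity) ?_
    exact_mod_cast pow_le_descFactorial_sq hkS
  rw [Real.logb_pow, Real.logb_pow] at h2
  rw [Nat.cast_mul, Nat.cast_pow, Real.logb_mul hd0.ne' (by positivity), Real.logb_pow] at h1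
  -- The factor 4 has two sources: the square above costs 2, and `k * log₂ (S + 1)` is used twice,
  -- for `k * log₂ S` and for the part `k * log₂ k` of `n * log₂ k`.
  have h3 : Real.logb 2 S ≤ Real.logb 2 ((S + 1 : ℕ) : ℝ) :=
    Real.logb_le_logb_of_le one_lt_two hS0 (by push_cast; linarith)
  have h4 : Real.logb 2 k ≤ Real.logb 2 ((S + 1 : ℕ) : ℝ) :=
    Real.logb_le_logb_of_le one_lt_two hk0 (by exact_mod_cast hkS)
  have h5 : 0 ≤ Real.logb 2 (k : ℝ) := Real.logb_nonneg one_lt_two (by exact_mod_cast hk)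
  have h6 := mul_le_mul_of_nonneg_left h3 hk0.le
  have h7 := mul_le_mul_of_nonneg_left h4 hk0.le
  have h8 : (0 : ℝ) ≤ m * Real.logb 2 k := by positivity
  push_cast at h2 ⊢
  push_cast at h6 h7
  nlinarith

/-- The number of inputs with `k` stripes is at most exponential in the volume of the transfers,
counted with weight `2 + 3 * log₂ M / w`. -/
theorem logb_card_le {B M w S n k T : ℕ} {A : Algorithm S n} (hA : SolvesWithin B M w k T A)
    (hw : 1 < w) (hM : 4 ≤ M) :
    Real.logb 2 ((Finset.univ.filter fun f : Fin n → Fin (S + 1) =>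
        (Finset.univ.image f).card = k).card : ℝ) ≤
      B * T * (2 + 3 * Real.logb 2 M / w) := by
  have hM' : (4 : ℝ) ≤ M := by exact_mod_cast hM
  have hw0 : (0 : ℝ) < w := by exact_mod_cast (by omega : 0 < w)
  have hlM : 0 ≤ Real.logb 2 (M : ℝ) := Real.logb_nonneg one_lt_two (by linarith)
  set R : ℝ := 2 ^ (2 + 3 * Real.logb 2 M / w) with hRdef
  have hR : 4 ≤ R := by
    calc (4 : ℝ) = 2 ^ (2 : ℝ) := by norm_num
      _ ≤ R := Real.rpow_le_rpow_of_exponent_le one_le_two (by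
        have : 0 ≤ 3 * Real.logb 2 (M : ℝ) / w := by positivity
        linarith)
  have hRw : (4 * (2 * M + 1) : ℝ) ≤ R ^ w := by
    -- The exponent 2 in `R` gives `R ≥ 4`, needed for small records; the term `3 * log₂ M / w`
    -- gives `M ^ 3`, which suffices for large ones.
    have h1 : R ^ w = 2 ^ (2 * w : ℝ) * (M : ℝ) ^ 3 := by
      have h2 : (M : ℝ) ^ 3 = 2 ^ (Real.logb 2 M * (3 : ℕ)) := by
        rw [Real.rpow_mul zero_le_two, Real.rpow_natCast,
          Real.rpow_logb two_pos (by norm_num) (by linarith)]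
      rw [h2, ← Real.rpow_add two_pos, hRdef, ← Real.rpow_natCast, ← Real.rpow_mul zero_le_two]
      congr 1
      field_simp
      push_cast
      ring
    have h3 : (1 : ℝ) ≤ 2 ^ (2 * w : ℝ) := Real.one_le_rpow one_le_two (by positivity)
    rw [h1]
    nlinarith [mul_le_mul hM' hM' (by norm_num) (by linarith), pow_pos (by linarith : (0:ℝ) < M) 3]
  have hcard := card_le_of_run (B := B) hR hRw A T ∅ (startDisk w S n)
    (Finset.univ.filter fun f : Fin n → Fin (S + 1) => (Finset.univ.image f).card = k) []
    (by simp) ⟨by simp, fun a ha => ?_, by simp⟩ fun f hf => ?_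
  · have hpot : potential R ∅ ([] : List (Rec S n)) = 1 := by
      simp [potential, runWeight, excess]
    rw [hpot, mul_one] at hcard
    set N := (Finset.univ.filter fun f : Fin n → Fin (S + 1) => (Finset.univ.image f).card = k).card
    rcases Nat.eq_zero_or_pos N with h0 | h0
    · rw [h0, Nat.cast_zero, Real.logb_zero]
      positivity
    · refine (Real.logb_le_logb_of_le one_lt_two (by exact_mod_cast h0) hcard).trans_eq ?_
      rw [Real.logb_pow, hRdef, Real.logb_rpow two_pos (by norm_num)]
      push_cast
      ring
  · have := ha (show ((Sum.inr a : Rec S n), 0) ∈ pieces w (Sum.inr a) by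
      simp [pieces, size]; omega)
    simp at this
  · exact hA _ (isInput_cfgKey f) (by rw [numStripes_cfgKey]; exact (Finset.mem_filter.1 hf).2)

/-- The trade-off between the two ways to pay for `E` bits: `Q` is the volume transferred, `m` the
logarithm of the memory size and `V` the volume of the large records. -/
theorem min_le_of_info {Q E m w V : ℝ} (hw : 0 < w) (hm : 0 < m)
    (hQ : 0 ≤ Q) (h : E ≤ 4 * (Q * (2 + 3 * m / w)))
    (hV : w * E ≤ 22 * (Q * m) ∨ V ≤ 2 * Q) :
    min (w * E / m) (E + V) ≤ 22 * Q := by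
  rcases le_total w m with hwm | hwm
  -- For `w ≤ m` the information bound alone gives `w * E ≤ 20 * Q * m`.
  · refine (min_le_left _ _).trans ?_
    rw [div_le_iff₀ hm]
    have h1 : w * E ≤ 4 * (Q * (2 * w + 3 * m)) := by
      calc w * E ≤ w * (4 * (Q * (2 + 3 * m / w))) := by gcongr
        _ = _ := by field_simp
    nlinarith
  · rcases hV with hV | hV
    · refine (min_le_left _ _).trans ?_
      rw [div_le_iff₀ hm]
      linarith
    -- For `m ≤ w` it gives `E ≤ 20 * Q`; adding `V ≤ 2 * Q` yields the constant 22.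
    · refine (min_le_right _ _).trans ?_
      have : m / w ≤ 1 := (div_le_one hw).2 hwm
      have h3 : 3 * m / w ≤ 3 := by rw [mul_div_assoc]; linarith
      have : Q * (2 + 3 * m / w) ≤ Q * 5 := by
        gcongr
        linarith
      linarith

/-- Split `log₂ S = log₂ (S / w) + log₂ w` and use `log₂ x ≤ x`: the first part costs at most `S`
after multiplication by `w`, the second at most `w * log₂ M`. This serves the case of one stripe in
which only the small records are known to move. -/
theorem mul_logb_le {w S M : ℕ} (hw : 1 < w) (hwM : w ≤ M) (hS : 1 ≤ S) {Q : ℝ}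
    (hwQ : (w : ℝ) ≤ Q) (hSQ : (S : ℝ) ≤ Q) (hM : 1 ≤ Real.logb 2 (M : ℝ)) :
    w * Real.logb 2 S ≤ 2 * (Q * Real.logb 2 M) := by
  have hw0 : (0 : ℝ) < w := by exact_mod_cast (by omega : 0 < w)
  have hS0 : (0 : ℝ) < S := by exact_mod_cast hS
  have h1 : Real.logb 2 S = Real.logb 2 (S / w) + Real.logb 2 w := by
    rw [Real.logb_div hS0.ne' hw0.ne']
    ring
  have h2 : Real.logb 2 (w : ℝ) ≤ Real.logb 2 M :=
    Real.logb_le_logb_of_le one_lt_two hw0 (by exact_mod_cast hwM)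
  have h3 : Real.logb 2 ((S : ℝ) / w) ≤ S / w := by
    rw [Real.logb_le_iff_le_rpow one_lt_two (by positivity)]
    obtain ⟨x, hx⟩ : ∃ x : ℝ, x = S / w := ⟨_, rfl⟩
    have hx0 : 0 < x := by rw [hx]; positivity
    rw [← hx]
    have hfl := Nat.lt_floor_add_one x
    have hpow : ((⌊x⌋₊ + 1 : ℕ) : ℝ) ≤ 2 ^ ⌊x⌋₊ := by exact_mod_cast Nat.lt_two_pow_self
    calc x ≤ ((⌊x⌋₊ + 1 : ℕ) : ℝ) := by push_cast; exact hfl.le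
      _ ≤ 2 ^ ⌊x⌋₊ := hpow
      _ = (2 : ℝ) ^ ((⌊x⌋₊ : ℕ) : ℝ) := (Real.rpow_natCast _ _).symm
      _ ≤ 2 ^ x := Real.rpow_le_rpow_of_exponent_le one_le_two (Nat.floor_le hx0.le)
  have hQ0 : 0 ≤ Q := hS0.le.trans hSQ
  calc w * Real.logb 2 S ≤ w * (S / w + Real.logb 2 M) := by rw [h1]; gcongr
    _ = S + w * Real.logb 2 M := by field_simp
    _ ≤ Q * Real.logb 2 M + Q * Real.logb 2 M := by
        gcongr
        nlinarith
    _ = _ := by ring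

end PLE

theorem theorem3 :
    ∃ c : ℝ, 0 < c ∧
      ∀ B M w S n k T : ℕ, 1 ≤ B → B ≤ M → 1 < w → 2 * w ≤ M →
        1 ≤ S → 1 ≤ k → k ≤ n → k ≤ S + 1 →
        ∀ L : ℝ, L = (n : ℝ) * (w : ℝ) →
        ∀ A : PLE.Algorithm S n, PLE.SolvesWithin B M w k T A →
          c * min
              ((k : ℝ) * (w : ℝ) / (B : ℝ) * Real.logb (M : ℝ) (S : ℝ)
                + L / (B : ℝ) * Real.logb (M : ℝ) (k : ℝ))
              ((k : ℝ) / (B : ℝ) * Real.logb 2 (S : ℝ)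
                + L / ((w : ℝ) * (B : ℝ)) * Real.logb 2 (k : ℝ)
                + L / (B : ℝ))
            ≤ (T : ℝ) := by
  refine ⟨1 / 22, by norm_num, ?_⟩
  rintro B M w S n k T hB hBM hw hwM hS hk hkn hkS L rfl A hA
  have hB0 : (0 : ℝ) < B := by exact_mod_cast hB
  have hw0 : (0 : ℝ) < w := by exact_mod_cast (by omega : 0 < w)
  have hM1 : 1 ≤ Real.logb 2 (M : ℝ) := by
    rw [Real.le_logb_iff_rpow_le one_lt_two (by exact_mod_cast (by omega : 0 < M))]
    rw [Real.rpow_one]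
    exact_mod_cast (by omega : 2 ≤ M)
  set m := Real.logb 2 (M : ℝ) with hm
  set E := k * Real.logb 2 (S : ℝ) + n * Real.logb 2 (k : ℝ) with hEdef
  set Q : ℝ := B * T with hQ
  have hlog : ∀ x : ℝ, Real.logb M x = Real.logb 2 x / m := fun x => by
    rw [hm]
    simp only [Real.logb]
    field_simp
  have hinfo : E ≤ 4 * (Q * (2 + 3 * m / w)) :=
    (PLE.four_mul_logb_card_ge hS hk hkn hkS).trans
      (mul_le_mul_of_nonneg_left (PLE.logb_card_le hA hw (by omega)) (by norm_num))
  have hvol : w * E ≤ 22 * (Q * m) ∨ (n * w : ℝ) ≤ 2 * Q := by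
    rcases Nat.lt_or_ge 1 k with hk2 | hk1
    · right
      have h1 := PLE.pred_mul_le_of_two_le hA hk2 hkn hkS
      have h2 : n * w ≤ 2 * (B * T) := by
        -- Since `n ≥ k ≥ 2`, the one record that may stay unread costs at most a factor 2.
        have : n * w ≤ 2 * (n - 1) * w := Nat.mul_le_mul_right _ (by omega)
        rw [mul_assoc] at this
        omega
      rw [hQ]
      exact_mod_cast h2
    · obtain rfl : k = 1 := le_antisymm hk1 hk
      have hwQ : (w : ℝ) ≤ Q := by rw [hQ]; exact_mod_cast PLE.size_le_of_one_stripe hA hS hkn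
      rcases PLE.volume_le_of_one_stripe hA hB hkn with h | h
      · left
        have hSQ : (S : ℝ) ≤ Q := by rw [hQ]; exact_mod_cast h
        have := PLE.mul_logb_le hw (by omega) hS hwQ hSQ hM1
        have hE1 : E = Real.logb 2 S := by simp [hEdef]
        rw [hE1]
        have : 0 ≤ Q * m := by positivity
        linarith
      · right
        have : (n * w : ℝ) ≤ Q := by rw [hQ]; exact_mod_cast h
        have : 0 ≤ Q := by positivity
        linarith
  have hmin := PLE.min_le_of_info hw0 (by linarith) (by positivity) hinfo hvol
  have e1 : (k : ℝ) * w / B * Real.logb M S + n * w / B * Real.logb M k = w * E / m / B := by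
    rw [hlog, hlog, hEdef]
    field_simp
  have e2 : (k : ℝ) / B * Real.logb 2 S + n * w / (w * B) * Real.logb 2 k + n * w / B
      = (E + n * w) / B := by
    rw [hEdef]
    field_simp
  rw [e1, e2, min_div_div_right hB0.le, ← mul_div_assoc, div_le_iff₀ hB0]
  linarith
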